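/- Consider a POMDP with a countable state set $S$, finite action and observation sets $A$ and $Z$, transition probabilities $p(s'\mid s,a)$, observation probabilities $p(z\mid s',a)$, rewards $0\le R(s,a)\le R_{\max}$ and discount factor $\gamma\in[0,1)$. Let $b_0$ be a probability distribution on $S$ (the initial belief), and fix a default policy, which chooses an action as a function of the history of actions and observations. A *policy tree* is a subtree, containing the root, of the tree of all histories $(a_1,z_1,\dots,a_t,z_t)$, in which every internal node has exactly one outgoing action edge. To execute it, the agent takes the action of the current internal node and follows the edge of the observation received; once it reaches a leaf or receives an observation for which there is no branch, it follows the default policy forever. The size $|\pi|$ of a policy tree $\pi$ is its number of internal nodes, and $V_\pi(b_0)=\mathbf E\bigl[\sum_{t\ge 0}\gamma^tR(s_t,a_{t+1})\bigr]$ is its expected total discounted reward when $s_0\sim b_0$, where $a_{t+1}$ is the action taken in state $s_t$. Let $g\colon S\times A\times\mathbb R\to S\times Z$ be a deterministic simulative model: if $\phi$ is uniform on $[0,1]$, then $g(s,a,\phi)$ has the law $p(s',z\mid s,a)=p(s'\mid s,a)\,p(z\mid s',a)$. A scenario for $b_0$ is a random sequence $(s_0,\phi_1,\phi_2,\dots)$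 of independent entries with $s_0\sim b_0$ and each $\phi_i$ uniform on $[0,1]$; simulating under it means setting $(s_t,z_t)=g(s_{t-1},a_t,\phi_t)$. Let $D,K\ge 1$ be integers and sample $K$ independent scenarios for $b_0$. The DESPOT $\mathcal D$ of height $D$ consists of all histories of length at most $D$ that arise by simulating some action sequence under some sampled scenario. Let $\Pi_{\mathcal D}$ be the set of policy trees derived from $\mathcal D$, that is, those all of whose internal nodes are nodes of $\mathcal D$ of depth less than $D$, with the observation branches that occur in $\mathcal D$. Let $\hat V_\pi(b_0)$ be the average, over the $K$ sampled scenarios, of the total discounted reward obtained by simulating $\pi$ under the scenario. **Theorem.** Let $\tau,\alpha\in(0,1)$ and let $\pi$ be an arbitrary policy tree of finite size at $b_0$ (for infinite size the bound below is void). With probability at least $1-\tau$ over the $K$ sampled scenarios, every $$\hat\pi\in\operatorname*{arg\,max}_{\pi'\in\Pi_{\mathcal D}}\left\{\frac{1-\alpha}{1+\alpha}\,\hat V_{\pi'}(b_0)-\frac{R_{\max}}{(1+\alpha)(1-\gamma)}\cdot\frac{|\pi'|\ln(KD|A||Z|)}{\alpha K}\right\}$$ satisfies $$V_{\hat\pi}(b_0)\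 \ge\ \frac{1-\alpha}{1+\alpha}\,V_\pi(b_0)-\frac{R_{\max}}{(1+\alpha)(1-\gamma)}\left(\frac{\ln(8/\tau)+|\pi|\ln(KD|A||Z|)}{\alpha K}+(1-\alpha)\left(\sqrt{\frac{2\ln(2/\tau)}{K}}+\gamma^{D}\right)\right).$$ -/

import Mathlib

open MeasureTheory

noncomputable section

namespace Despot

/-- A POMDP `(S, A, Z, T, O, R)` with discrete transition probabilities `T s a s' = p(s' | s, a)`,
observation probabilities `O s' a z = p(z | s', a)` and rewards `R s a`. -/
structure POMDP (S A Z : Type*) where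
  T : S → A → PMF S
  O : S → A → PMF Z
  R : S → A → ℝ

/-- A history `(a₁, z₁, …, a_t, z_t)` in chronological order. The histories are the nodes of the
standard belief tree; `[]` is the root and represents the initial belief. -/
abbrev History (A Z : Type*) := List (A × Z)

/-- A complete rule for acting. A policy that acts on the current belief is of this form, because
the belief is a function of the initial belief and of the history. -/
abbrev Strategy (A Z : Type*) := History A Z → A

/-- A (finite or infinite) policy tree: a subtree of the belief tree in which every internal node
has exactly one outgoing action edge. `choice h = some a` says that `h` is an internal node with
action `a`, and `choice h = none` that `h` is a leaf or is not in the tree. A node below an action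
edge can be in the tree only if that edge is the one chosen at the parent. -/
structure PolicyTree (A Z : Type*) where
  choice : History A Z → Option A
  choice_parent : ∀ (h : History A Z) (a : A) (z : Z),
    choice (h ++ [(a, z)]) ≠ none → choice h = some a

namespace PolicyTree

variable {A Z : Type*}

/-- The internal nodes of a policy tree. -/
def internal (p : PolicyTree A Z) : Set (History A Z) := {h | p.choice h ≠ none}

/-- The size of a policy tree with finitely many internal nodes: their number. -/
def size (p : PolicyTree A Z) : ℕ := p.internal.ncard

/-- Executing a policy tree: the prescribed action is taken at internal nodes; the default policy
is followed from the moment on when a leaf is reached or the tree is left. -/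
def exec (p : PolicyTree A Z) (dflt : Strategy A Z) : Strategy A Z :=
  fun h => (p.choice h).getD (dflt h)

end PolicyTree

section Value

variable {S A Z : Type*}

/-- The joint law of the state `s_t` and the history `h_t` at time `t`, when the strategy `act` is
executed from the initial belief `b`. -/
def POMDP.law (M : POMDP S A Z) (b : PMF S) (act : Strategy A Z) : ℕ → PMF (S × History A Z)
  | 0 => b.map fun s => (s, [])
  | t + 1 => (M.law b act t).bind fun x =>
      (M.T x.1 (act x.2)).bind fun s' =>
        (M.O s' (act x.2)).map fun z => (s', x.2 ++ [(act x.2, z)])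

/-- The expected reward `E[R(s_t, a_t)]` at time `t`. -/
def POMDP.expectedReward (M : POMDP S A Z) (b : PMF S) (act : Strategy A Z) (t : ℕ) : ℝ :=
  ∑' x : S × History A Z, (M.law b act t x).toReal * M.R x.1 (act x.2)

/-- The value at the belief `b`: the expected total discounted reward. -/
def POMDP.value (M : POMDP S A Z) (γ : ℝ) (b : PMF S) (act : Strategy A Z) : ℝ :=
  ∑' t : ℕ, γ ^ t * M.expectedReward b act t

end Value

section Scenarios

variable {S A Z : Type*}

/-- The uniform distribution on `[0, 1]`. -/
def uniform01 : Measure ℝ := volume.restrict (Set.Icc 0 1)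

instance : IsProbabilityMeasure uniform01 := ⟨by simp [uniform01]⟩

/-- A scenario `(s₀, φ₁, φ₂, …)`; the number `φ_{t+1}` is `φ.2 t`. -/
abbrev Scenario (S : Type*) := S × (ℕ → ℝ)

/-- The law of a scenario for the belief `b`: the start state is drawn from `b`, and the numbers
are independent of it and of each other and uniform on `[0, 1]`. -/
def scenarioLaw [MeasurableSpace S] (b : PMF S) : Measure (Scenario S) :=
  b.toMeasure.prod (Measure.infinitePi fun _ : ℕ => uniform01)

/-- The law of `K` independent scenarios for the belief `b`. -/
def sampleLaw [MeasurableSpace S] (b : PMF S) (K : ℕ) : Measure (Fin K → Scenario S) :=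
  Measure.pi fun _ => scenarioLaw b

/-- `g` is a deterministic simulative model of `M`: if `φ` is uniform on `[0, 1]`, then
`g s a φ` is distributed according to `p(s', z | s, a) = T(s, a, s') O(s', a, z)`. -/
structure IsSimulativeModel [MeasurableSpace S] [MeasurableSpace Z] (M : POMDP S A Z)
    (g : S → A → ℝ → S × Z) : Prop where
  measurable : ∀ s a, Measurable (g s a)
  distributed : ∀ s a s' z,
    uniform01 {x | g s a x = (s', z)} = M.T s a s' * M.O s' a z

/-- The state `s_t` and the history `h_t` reached after `t` steps when the strategy `act` is
simulated under the scenario `φ`. -/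
def simulate (g : S → A → ℝ → S × Z) (act : Strategy A Z) (φ : Scenario S) :
    ℕ → S × History A Z
  | 0 => (φ.1, [])
  | t + 1 =>
      let x := simulate g act φ t
      let y := g x.1 (act x.2) (φ.2 t)
      (y.1, x.2 ++ [(act x.2, y.2)])

/-- The total discounted reward of the simulated trajectory. -/
def scenarioValue (M : POMDP S A Z) (g : S → A → ℝ → S × Z) (γ : ℝ) (act : Strategy A Z)
    (φ : Scenario S) : ℝ :=
  ∑' t : ℕ, γ ^ t * M.R (simulate g act φ t).1 (act (simulate g act φ t).2)

/-- The empirical value at the root: the average over the `K` sampled scenarios. -/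
def empiricalValue (M : POMDP S A Z) (g : S → A → ℝ → S × Z) (γ : ℝ) {K : ℕ}
    (φ : Fin K → Scenario S) (act : Strategy A Z) : ℝ :=
  (∑ k, scenarioValue M g γ act (φ k)) / K

/-- The nodes of the DESPOT of height `D` for the scenarios `φ`: all nodes of depth at most `D` on
the paths traced out by simulating all action sequences `u` under all the scenarios. -/
def despotNodes (g : S → A → ℝ → S × Z) {K : ℕ} (φ : Fin K → Scenario S) (D : ℕ) :
    Set (History A Z) :=
  {h | ∃ (u : ℕ → A) (k : Fin K) (t : ℕ), t ≤ D ∧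
    h = (simulate g (fun h' => u h'.length) (φ k) t).2}

/-- The policy trees derived from the DESPOT of height `D` for the scenarios `φ`: each of their
internal nodes is an internal node of the DESPOT, that is, a node of depth less than `D`. -/
def despotPolicies (g : S → A → ℝ → S × Z) {K : ℕ} (φ : Fin K → Scenario S) (D : ℕ) :
    Set (PolicyTree A Z) :=
  {p | ∀ h ∈ p.internal, h ∈ despotNodes g φ D ∧ h.length < D}

/-- The regularized empirical value of a policy tree. -/
def regularizedValue [Fintype A] [Fintype Z] (M : POMDP S A Z) (g : S → A → ℝ → S × Z)
    (γ Rmax α : ℝ) (dflt : Strategy A Z) {K : ℕ} (φ : Fin K → Scenario S) (D : ℕ)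
    (p : PolicyTree A Z) : ℝ :=
  (1 - α) / (1 + α) * empiricalValue M g γ φ (p.exec dflt)
    - Rmax / ((1 + α) * (1 - γ)) *
      ((p.size : ℝ) * Real.log ((K : ℝ) * D * Fintype.card A * Fintype.card Z) / (α * K))

end Scenarios

end Despot

end

open MeasureTheory

/-! For a fixed strategy the scenario values are `K` independent variables in [0, B], B =
R_max/(1-γ), with mean the true value (`integral_scenarioValue`). The maximiser, and even the class
it ranges over, depend on the sample. So its value is bounded below uniformly over a class fixed in
advance: all policy trees with at most KD internal nodes. Derived trees belong to it, because each
internal node is visited by the tree's own execution within the first `D` steps of some scenario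
(`size_le_of_mem_despotPolicies`).

Trees of size i get the relative Chernoff bound `measureReal_integral_lt_empirical_mean_le` at level
L = ln(8/τ) + i ln(KD|A||Z|). By the count `exists_finset_policyTree_of_size` their failure
probabilities sum to at most τ/4 (`sum_card_mul_exp_le`). Up to the constant ln(8/τ), this level is
exactly the regularization penalty.

The competitor π needs only one Hoeffding bound. Truncated to the DESPOT it becomes an admissible
tree that is no larger and loses at most γ^D B empirically
(`exists_mem_despotPolicies_empiricalValue_le`). Maximality of the regularized value joins the two
estimates. -/

namespace Despot


/-! ### Concentration of empirical means -/

section Concentration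

variable {Ω : Type*} [MeasurableSpace Ω] {ν : Measure Ω} [IsProbabilityMeasure ν]
  {X : Ω → ℝ} {B : ℝ}

theorem integrable_of_mem_Icc (hX : Measurable X) (h : ∀ ω, X ω ∈ Set.Icc 0 B) :
    Integrable X ν :=
  Integrable.of_mem_Icc 0 B hX.aemeasurable (.of_forall h)

theorem integral_mem_Icc (hX : Measurable X) (h : ∀ ω, X ω ∈ Set.Icc 0 B) :
    ∫ ω, X ω ∂ν ∈ Set.Icc 0 B := by
  refine ⟨integral_nonneg fun ω => (h ω).1, ?_⟩
  calc ∫ ω, X ω ∂ν ≤ ∫ _, B ∂ν :=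
        integral_mono (integrable_of_mem_Icc hX h) (integrable_const _) fun ω => (h ω).2
    _ = B := by simp

theorem integrable_exp_mul_of_mem_Icc (hX : Measurable X) (h : ∀ ω, X ω ∈ Set.Icc 0 B)
    {t : ℝ} (ht : 0 ≤ t) : Integrable (fun ω => Real.exp (t * X ω)) ν := by
  refine Integrable.of_mem_Icc 0 (Real.exp (t * B)) (by fun_prop) (.of_forall fun ω => ?_)
  exact ⟨(Real.exp_pos _).le,
    Real.exp_le_exp.2 (mul_le_mul_of_nonneg_left (h ω).2 ht)⟩

/-- From e^y ≤ 1 + y + y² for |y| ≤ 1. Since X² ≤ BX, the quadratic term is linear in the mean,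
which is what makes the resulting deviation bound relative. -/
theorem mgf_le_of_mem_Icc (hX : Measurable X) (h : ∀ ω, X ω ∈ Set.Icc 0 B)
    {t : ℝ} (ht : 0 ≤ t) (htB : t * B ≤ 1) :
    ProbabilityTheory.mgf X ν t ≤ Real.exp ((t + t ^ 2 * B) * ∫ ω, X ω ∂ν) := by
  have hi := integrable_of_mem_Icc (ν := ν) hX h
  calc ProbabilityTheory.mgf X ν t
      ≤ ∫ ω, (1 + (t + t ^ 2 * B) * X ω) ∂ν := by
        refine integral_mono (integrable_exp_mul_of_mem_Icc hX h ht)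
          ((integrable_const _).add (hi.const_mul _)) fun ω => ?_
        obtain ⟨h0, hB⟩ := h ω
        have h1 : 0 ≤ t * X ω := mul_nonneg ht h0
        have h2 : t * X ω ≤ 1 := (mul_le_mul_of_nonneg_left hB ht).trans htB
        have h3 := (abs_le.1 (Real.abs_exp_sub_one_sub_id_le (abs_le.2 ⟨by linarith, h2⟩))).2
        have h4 : X ω ^ 2 ≤ B * X ω := by nlinarith
        have h5 := mul_le_mul_of_nonneg_left h4 (sq_nonneg t)
        simp only
        nlinarith
    _ = (t + t ^ 2 * B) * ∫ ω, X ω ∂ν + 1 := by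
        rw [integral_add (integrable_const _) (hi.const_mul _), integral_const_mul]
        simp [add_comm]
    _ ≤ _ := Real.add_one_le_exp _

/-- A one-sided relative deviation bound for the empirical mean of `K` independent copies of a
random variable with values in `[0, B]`. -/
theorem measureReal_integral_lt_empirical_mean_le (hX : Measurable X)
    (h : ∀ ω, X ω ∈ Set.Icc 0 B) {K : ℕ} (hK : 0 < K) {α : ℝ} (hα0 : 0 < α) (hα1 : α < 1)
    (L : ℝ) :
    (Measure.pi fun _ : Fin K => ν).real
      {φ | ∫ ω, X ω ∂ν < (1 - α) / (1 + α) * ((∑ k, X (φ k)) / K) - B / (1 + α) * (L / (α * K))}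
      ≤ Real.exp (-L) := by
  have hK' : (0 : ℝ) < K := by exact_mod_cast hK
  have hm := integral_mem_Icc (ν := ν) hX h
  set m := ∫ ω, X ω ∂ν
  rcases (hm.1.trans hm.2).eq_or_lt with hB | hB
  · have h0 : ∀ ω, X ω = 0 := fun ω => le_antisymm ((h ω).2.trans hB.ge) (h ω).1
    have : {φ : Fin K → Ω | m < (1 - α) / (1 + α) * ((∑ k, X (φ k)) / K)
        - B / (1 + α) * (L / (α * K))} = ∅ := by
      ext φ
      simp [h0, ← hB, hm.1]
    rw [this]
    simpa using (Real.exp_pos _).le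
  -- This exponent gives t * ε the summand L exactly, and the remaining terms in the mean have a
  -- nonpositive sum. It divides by `B`, hence the separate case above.
  set t := α * (1 - α) / B
  have hα' : 0 < 1 - α := by linarith
  have ht : 0 ≤ t := by positivity
  have htB : t * B = α * (1 - α) := by simp only [t]; field_simp
  have hmeas : ∀ k : Fin K, Measurable fun φ : Fin K → Ω => X (φ k) := fun k =>
    hX.comp (measurable_pi_apply k)
  have hsum : ∀ φ : Fin K → Ω, (∑ k, fun φ : Fin K → Ω => X (φ k)) φ ∈ Set.Icc 0 (K * B) := by
    intro φ
    rw [Finset.sum_apply]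
    refine ⟨Finset.sum_nonneg fun k _ => (h _).1, ?_⟩
    simpa using Finset.sum_le_card_nsmul Finset.univ (fun k => X (φ k)) B fun k _ => (h _).2
  have hmgf : ProbabilityTheory.mgf (∑ k, fun φ : Fin K → Ω => X (φ k))
      (Measure.pi fun _ : Fin K => ν) t = ProbabilityTheory.mgf X ν t ^ K := by
    rw [(ProbabilityTheory.iIndepFun_pi (X := fun _ : Fin K => X)
      fun _ => hX.aemeasurable).mgf_sum hmeas]
    have : ∀ k : Fin K, ProbabilityTheory.mgf (fun φ : Fin K → Ω => X (φ k))
        (Measure.pi fun _ : Fin K => ν) t = ProbabilityTheory.mgf X ν t := by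
      intro k
      exact integral_comp_eval (μ := fun _ : Fin K => ν) (i := k)
        (f := fun ω => Real.exp (t * X ω)) (by fun_prop)
    simp [this]
  set ε := K * ((1 + α) / (1 - α)) * m + B * L / (α * (1 - α))
  calc _ ≤ (Measure.pi fun _ : Fin K => ν).real
        {φ | ε ≤ (∑ k, fun φ : Fin K → Ω => X (φ k)) φ} := by
        refine measureReal_mono fun φ hφ => ?_
        simp only [Set.mem_ofPred_eq, Finset.sum_apply] at hφ ⊢
        have h1 := mul_lt_mul_of_pos_right hφ (show 0 < K * ((1 + α) / (1 - α)) by positivity)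
        have h2 : ((1 - α) / (1 + α) * ((∑ k, X (φ k)) / K) - B / (1 + α) * (L / (α * K)))
            * (K * ((1 + α) / (1 - α))) = ∑ k, X (φ k) - B * L / (α * (1 - α)) := by
          field_simp
        rw [h2] at h1
        simp only [ε]
        linarith
    _ ≤ Real.exp (-t * ε) * ProbabilityTheory.mgf (∑ k, fun φ : Fin K → Ω => X (φ k))
          (Measure.pi fun _ : Fin K => ν) t :=
        ProbabilityTheory.measure_ge_le_exp_mul_mgf ε ht
          (integrable_exp_mul_of_mem_Icc (by fun_prop) hsum ht)
    _ ≤ Real.exp (-t * ε) * Real.exp ((t + t ^ 2 * B) * m) ^ K := by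
        rw [hmgf]
        gcongr
        · exact ProbabilityTheory.mgf_nonneg
        · exact mgf_le_of_mem_Icc hX h ht (by rw [htB]; nlinarith)
    _ = Real.exp (-t * ε + K * ((t + t ^ 2 * B) * m)) := by
        rw [← Real.exp_nat_mul, ← Real.exp_add]
    _ ≤ Real.exp (-L) := by
        refine Real.exp_le_exp.2 ?_
        have h1 : -t * ε + K * ((t + t ^ 2 * B) * m)
            = -L - K * (m / B) * (α ^ 2 * (1 + α * (2 - α))) := by
          simp only [t, ε]
          field_simp
          ring
        have h2 : 0 ≤ K * (m / B) * (α ^ 2 * (1 + α * (2 - α))) := by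
          have h3 : 0 ≤ 2 - α := by linarith
          have := hm.1
          positivity
        linarith

/-- Hoeffding's inequality for the lower tail: the negated centred variables are sub-Gaussian with
parameter (B/2)². -/
theorem measureReal_empirical_mean_lt_le (hX : Measurable X)
    (h : ∀ ω, X ω ∈ Set.Icc 0 B) {K : ℕ} (hK : 0 < K) {ε : ℝ} (hε : 0 ≤ ε) :
    (Measure.pi fun _ : Fin K => ν).real
      {φ | (∑ k, X (φ k)) / K < ∫ ω, X ω ∂ν - B * ε} ≤ Real.exp (-2 * K * ε ^ 2) := by
  have hK' : (0 : ℝ) < K := by exact_mod_cast hK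
  have hm := integral_mem_Icc (ν := ν) hX h
  set m := ∫ ω, X ω ∂ν
  rcases (hm.1.trans hm.2).eq_or_lt with hB | hB
  · have h0 : ∀ ω, X ω = 0 := fun ω => le_antisymm ((h ω).2.trans hB.ge) (h ω).1
    have hm0 : m ≤ 0 := hm.2.trans hB.ge
    have : {φ : Fin K → Ω | (∑ k, X (φ k)) / K < m - B * ε} = ∅ := by
      ext φ
      simp [h0, ← hB, hm0]
    rw [this]
    simpa using (Real.exp_pos _).le
  have hsub := ProbabilityTheory.hasSubgaussianMGF_of_mem_Icc (μ := ν) (X := X) hX.aemeasurable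
    (.of_forall h)
  have hsub' : ∀ k ∈ (Finset.univ : Finset (Fin K)),
      ProbabilityTheory.HasSubgaussianMGF (fun φ : Fin K → Ω => -(X (φ k) - m))
        ((‖B - 0‖₊ / 2) ^ 2) (Measure.pi fun _ : Fin K => ν) := by
    intro k _
    refine (ProbabilityTheory.HasSubgaussianMGF.of_map (Y := fun φ : Fin K → Ω => φ k)
      (X := fun ω => X ω - m) (measurable_pi_apply k).aemeasurable ?_).neg
    rw [(measurePreserving_eval (fun _ : Fin K => ν) k).map_eq]
    exact hsub
  have hind : ProbabilityTheory.iIndepFun (fun (k : Fin K) (φ : Fin K → Ω) => -(X (φ k) - m))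
      (Measure.pi fun _ : Fin K => ν) :=
    ProbabilityTheory.iIndepFun_pi (X := fun _ : Fin K => fun ω => -(X ω - m))
      fun _ => by fun_prop
  have key := ProbabilityTheory.HasSubgaussianMGF.measure_sum_ge_le_of_iIndepFun hind hsub'
    (ε := K * (B * ε)) (by positivity)
  calc _ ≤ (Measure.pi fun _ : Fin K => ν).real
        {φ | K * (B * ε) ≤ ∑ k, -(X (φ k) - m)} := by
        refine measureReal_mono fun φ hφ => ?_
        simp only [Set.mem_ofPred_eq] at hφ ⊢
        rw [div_lt_iff₀ hK'] at hφ
        simp only [neg_sub, Finset.sum_sub_distrib, Finset.sum_const, Finset.card_univ,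
          Fintype.card_fin, nsmul_eq_mul]
        nlinarith
    _ ≤ _ := key
    _ = _ := by
        congr 1
        simp only [sub_zero, Finset.sum_const, Finset.card_univ, Fintype.card_fin, nsmul_eq_mul,
          NNReal.coe_mul, NNReal.coe_natCast, NNReal.coe_pow, NNReal.coe_div, coe_nnnorm,
          Real.norm_eq_abs, abs_of_pos hB, NNReal.coe_ofNat]
        field_simp

end Concentration


/-! ### Counting policy trees -/

section Counting

variable {A Z : Type*}

theorem PolicyTree.choice_injective :
    Function.Injective (PolicyTree.choice : PolicyTree A Z → History A Z → Option A) := by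
  rintro ⟨c, hc⟩ ⟨d, hd⟩ rfl
  rfl

/-- Removing a deepest internal node from a policy tree. -/
theorem PolicyTree.exists_remove [DecidableEq A] [DecidableEq Z] (q : PolicyTree A Z) (hq : q.internal.Finite) {i : ℕ}
    (hi : q.size = i + 1) :
    ∃ (p : PolicyTree A Z) (h : History A Z) (a : A), p.internal.Finite ∧ p.size = i ∧
      (i ≠ 0 → h ≠ []) ∧ (∀ h' b z, h = h' ++ [(b, z)] → p.choice h' = some b) ∧
      q.choice = fun x => if x = h then some a else p.choice x := by
  classical
  have hne : q.internal.Nonempty := by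
    rw [← Set.ncard_pos hq, ← PolicyTree.size]
    exact hi.symm ▸ Nat.succ_pos i
  -- No internal node lies below a deepest one, so deleting it leaves a policy tree.
  obtain ⟨h, hh, hmax⟩ := Set.exists_max_image q.internal List.length hq hne
  obtain ⟨a, ha⟩ := Option.ne_none_iff_exists'.1 hh
  let p : PolicyTree A Z :=
    { choice := fun x => if x = h then none else q.choice x
      choice_parent := by
        intro x b z hx
        have hx1 : x ++ [(b, z)] ≠ h := fun e => hx (by simp [e])
        have hx2 : q.choice (x ++ [(b, z)]) ≠ none := by simpa [hx1] using hx
        have hx3 : x ≠ h := by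
          rintro rfl
          have := hmax _ hx2
          simp at this
        simpa [hx3] using q.choice_parent x b z hx2 }
  have hp : p.internal = q.internal \ {h} := by
    ext x
    by_cases hx : x = h <;> simp [p, PolicyTree.internal, hx]
  refine ⟨p, h, a, hp ▸ hq.sdiff, ?_, ?_, ?_, ?_⟩
  · rw [PolicyTree.size, hp, Set.ncard_sdiff_singleton_of_mem hh]
    exact Nat.sub_eq_of_eq_add hi
  · rintro hi0 rfl
    have hsub : q.internal ⊆ {[]} := fun x hx => by simpa using hmax x hx
    have := Set.ncard_le_ncard hsub
    rw [Set.ncard_singleton, ← PolicyTree.size] at this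
    omega
  · rintro h' b z rfl
    have : h' ≠ h' ++ [(b, z)] := by simp
    simpa [p, this] using q.choice_parent h' b z hh
  · funext x
    by_cases hx : x = h <;> simp [p, hx, ha]

/-- Lets the count proceed on bare choice functions: `G` may contain functions that violate
`choice_parent`. -/
theorem exists_finset_of_forall_choice_mem {P : PolicyTree A Z → Prop}
    (G : Finset (History A Z → Option A)) (hG : ∀ p, P p → p.choice ∈ G) :
    ∃ F : Finset (PolicyTree A Z), (∀ p, p ∈ F ↔ P p) ∧ F.card ≤ G.card := by
  classical
  have hfin : {p | P p}.Finite :=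
    Set.Finite.of_injOn (fun p hp => hG p hp) (PolicyTree.choice_injective.injOn) G.finite_toSet
  refine ⟨hfin.toFinset, by simp, ?_⟩
  exact Finset.card_le_card_of_injOn PolicyTree.choice (fun p hp => hG p (by simpa using hp))
    PolicyTree.choice_injective.injOn

/-- There are at most `(i - 1)! (|A| |Z|) ^ i` policy trees of size `i`. -/
theorem exists_finset_policyTree_of_size [Fintype A] [Fintype Z] [Nonempty A] [Nonempty Z]
    (i : ℕ) :
    ∃ F : Finset (PolicyTree A Z), (∀ p, p ∈ F ↔ p.internal.Finite ∧ p.size = i) ∧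
      F.card ≤ (i - 1).factorial * (Fintype.card A * Fintype.card Z) ^ i := by
  classical
  induction i with
  | zero =>
    -- Infinite sets have `ncard` zero, so finiteness must be required separately.
    obtain ⟨F, hF, hc⟩ := exists_finset_of_forall_choice_mem
      (P := fun p : PolicyTree A Z => p.internal.Finite ∧ p.size = 0) {fun _ => none} (by
        rintro p ⟨hp, h0⟩
        have h1 : p.internal = ∅ := (Set.ncard_eq_zero hp).1 h0
        refine Finset.mem_singleton.2 (funext fun x => ?_)
        by_contra hx
        exact Set.eq_empty_iff_forall_notMem.1 h1 x hx)
    exact ⟨F, hF, by simpa using hc⟩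
  | succ i ih =>
    obtain ⟨F, hF, hcard⟩ := ih
    rcases i.eq_zero_or_pos with rfl | hi
    · obtain ⟨F', hF', hc⟩ := exists_finset_of_forall_choice_mem
        (P := fun p : PolicyTree A Z => p.internal.Finite ∧ p.size = 0 + 1)
        (Finset.univ.image fun (a : A) x => if x = [] then some a else none) (by
          rintro q ⟨hq, h1⟩
          obtain ⟨p, h, a, hp, hp0, -, hpar, he⟩ := q.exists_remove hq h1
          have h1 : p.internal = ∅ := (Set.ncard_eq_zero hp).1 hp0
          have hnone : ∀ x, p.choice x = none := fun x => by
            by_contra hx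
            exact Set.eq_empty_iff_forall_notMem.1 h1 x hx
          have hnil : h = [] := by
            rcases h.eq_nil_or_concat' with h0 | ⟨h', ⟨b, z⟩, h0⟩
            · exact h0
            · simpa [hnone] using hpar h' b z h0
          subst hnil
          exact Finset.mem_image.2 ⟨a, Finset.mem_univ _, by simp [he, hnone]⟩)
      refine ⟨F', hF', hc.trans (Finset.card_image_le.trans ?_)⟩
      simpa using Nat.le_mul_of_pos_right _ (Fintype.card_pos (α := Z))
    · obtain ⟨F', hF', hc⟩ := exists_finset_of_forall_choice_mem
        (P := fun p : PolicyTree A Z => p.internal.Finite ∧ p.size = i + 1)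
        -- A tree of size i + 1 arises from one of size i by choosing a parent among i internal
        -- nodes, an observation and a new action; the edge out of the parent is forced. The default
        -- of `getD` is never used, as the parent is internal.
        (F.biUnion fun p => if hp : p.internal.Finite then
          (hp.toFinset ×ˢ (Finset.univ : Finset (A × Z))).image fun y x =>
            if x = y.1 ++ [((p.choice y.1).getD y.2.1, y.2.2)] then some y.2.1 else p.choice x
          else ∅) (by
          rintro q ⟨hq, h1⟩
          obtain ⟨p, h, a, hp, hpi, hne, hpar, he⟩ := q.exists_remove hq h1
          refine Finset.mem_biUnion.2 ⟨p, (hF p).2 ⟨hp, hpi⟩, ?_⟩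
          rw [dif_pos hp]
          obtain ⟨h', ⟨b, z⟩, rfl⟩ := (h.eq_nil_or_concat').resolve_left (hne hi.ne')
          have hb := hpar h' b z rfl
          refine Finset.mem_image.2 ⟨(h', a, z), by simp [PolicyTree.internal, hb], ?_⟩
          simp [he, hb])
      refine ⟨F', hF', hc.trans ((Finset.card_biUnion_le_card_mul _ _
        (i * (Fintype.card A * Fintype.card Z)) ?_).trans ?_)⟩
      · intro p hp
        obtain ⟨hp1, hp2⟩ := (hF p).1 hp
        rw [dif_pos hp1]
        refine Finset.card_image_le.trans ?_
        rw [Finset.card_product, ← Set.ncard_eq_toFinset_card _ hp1]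
        simp [← hp2, PolicyTree.size]
      · calc F.card * (i * (Fintype.card A * Fintype.card Z))
            ≤ ((i - 1).factorial * (Fintype.card A * Fintype.card Z) ^ i)
              * (i * (Fintype.card A * Fintype.card Z)) := Nat.mul_le_mul_right _ hcard
          _ = i * (i - 1).factorial * (Fintype.card A * Fintype.card Z) ^ (i + 1) := by ring
          _ = _ := by rw [Nat.mul_factorial_pred hi.ne', Nat.add_sub_cancel]

end Counting


/-! ### Simulation reproduces the law of execution -/

section Law

variable {S A Z : Type*} {g : S → A → ℝ → S × Z}

theorem simulate_congr (g : S → A → ℝ → S × Z) (act : Strategy A Z) {φ ψ : Scenario S} {t : ℕ}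
    (h0 : φ.1 = ψ.1) (h : ∀ i < t, φ.2 i = ψ.2 i) : simulate g act φ t = simulate g act ψ t := by
  induction t with
  | zero => simp [simulate, h0]
  | succ t ih =>
    simp only [simulate, ih fun i hi => h i (hi.trans t.lt_succ_self), h t t.lt_succ_self]

theorem simulate_length (g : S → A → ℝ → S × Z) (act : Strategy A Z) (φ : Scenario S) (t : ℕ) :
    (simulate g act φ t).2.length = t := by
  induction t with
  | zero => simp [simulate]
  | succ t ih => simp [simulate, ih]

/-- One step of the simulation, as a function of the state, the history and the random number. -/
def simulateStep (g : S → A → ℝ → S × Z) (act : Strategy A Z) (x : S × History A Z) (r : ℝ) :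
    S × History A Z :=
  ((g x.1 (act x.2) r).1, x.2 ++ [(act x.2, (g x.1 (act x.2) r).2)])

theorem simulate_succ (g : S → A → ℝ → S × Z) (act : Strategy A Z) (φ : Scenario S) (t : ℕ) :
    simulate g act φ (t + 1) = simulateStep g act (simulate g act φ t) (φ.2 t) := rfl

variable [Countable S] [MeasurableSpace S] [DiscreteMeasurableSpace S]
  [Finite A] [Finite Z] [MeasurableSpace Z] [DiscreteMeasurableSpace Z]
  {M : POMDP S A Z}

omit [Finite A] in
theorem measurableSet_simulateStep (hg : IsSimulativeModel M g) (act : Strategy A Z)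
    (x y : S × History A Z) : MeasurableSet {r | simulateStep g act x r = y} :=
  (hg.measurable x.1 (act x.2))
    (.of_discrete (s := {w : S × Z | (w.1, x.2 ++ [(act x.2, w.2)]) = y}))

/-- Histories carry no σ-algebra here; since the pairs of state and history are countably many,
measurability of the fibres suffices. -/
theorem measurableSet_simulate_eq (hg : IsSimulativeModel M g) (act : Strategy A Z) (t : ℕ)
    (x : S × History A Z) : MeasurableSet {φ : Scenario S | simulate g act φ t = x} := by
  induction t generalizing x with
  | zero =>
    exact measurable_fst (.of_discrete (s := {s : S | (s, ([] : History A Z)) = x}))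
  | succ t ih =>
    have : {φ : Scenario S | simulate g act φ (t + 1) = x} = ⋃ y : S × History A Z,
        {φ : Scenario S | simulate g act φ t = y} ∩
          (fun φ : Scenario S => φ.2 t) ⁻¹' {r | simulateStep g act y r = x} := by
      ext φ
      simp [simulate_succ]
    rw [this]
    exact .iUnion fun y => (ih y).inter
      (((measurable_pi_apply t).comp measurable_snd) (measurableSet_simulateStep hg act y x))

theorem measurable_comp_simulate (hg : IsSimulativeModel M g) (act : Strategy A Z) (t : ℕ)
    {β : Type*} [MeasurableSpace β] (f : S × History A Z → β) :
    Measurable fun φ : Scenario S => f (simulate g act φ t) := by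
  intro s _
  have : (fun φ : Scenario S => f (simulate g act φ t)) ⁻¹' s =
      ⋃ x ∈ f ⁻¹' s, {φ : Scenario S | simulate g act φ t = x} := by
    ext φ
    simp
  rw [this]
  exact .biUnion (Set.to_countable _) fun x _ => measurableSet_simulate_eq hg act t x

/-- The random number of step `t` is independent of the state and the history at time `t`. -/
theorem scenarioLaw_simulate_inter (hg : IsSimulativeModel M g) (b : PMF S) (act : Strategy A Z)
    (t : ℕ) (x : S × History A Z) {B : Set ℝ} (hB : MeasurableSet B) :
    scenarioLaw b ({φ | simulate g act φ t = x} ∩ (fun φ => φ.2 t) ⁻¹' B)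
      = scenarioLaw b {φ | simulate g act φ t = x} * uniform01 B := by
  have hX : MeasurableSet {φ : Scenario S | simulate g act φ t = x} :=
    measurableSet_simulate_eq hg act t x
  have hY : MeasurableSet ((fun φ : Scenario S => φ.2 t) ⁻¹' B) :=
    ((measurable_pi_apply t).comp measurable_snd) hB
  rw [scenarioLaw, Measure.prod_apply (hX.inter hY), Measure.prod_apply hX,
    ← lintegral_mul_const _ (measurable_measure_prodMk_left hX)]
  refine lintegral_congr fun s => ?_
  have hind := (ProbabilityTheory.iIndepFun_infinitePi (P := fun _ : ℕ => uniform01)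
    (X := fun _ => id) fun _ => measurable_id).indepFun_finset (Finset.range t) {t} (by simp)
    fun i => measurable_pi_apply i
  -- Padding with zeros is harmless: the first `t` steps read only the random numbers with index
  -- below `t`.
  let ext (r : Finset.range t → ℝ) : Scenario S :=
    (s, fun i => if h : i ∈ Finset.range t then r ⟨i, h⟩ else 0)
  have hext : Measurable ext := by
    refine measurable_const.prodMk (measurable_pi_lambda _ fun i => ?_)
    by_cases h : i ∈ Finset.range t
    · simpa [h] using measurable_pi_apply _
    · simp [h]
  have key := hind.measure_inter_preimage_eq_mul (ext ⁻¹' {φ | simulate g act φ t = x})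
    ((fun r => r ⟨t, Finset.mem_singleton_self t⟩) ⁻¹' B) (hext hX) (measurable_pi_apply _ hB)
  have h1 : (fun (f : ℕ → ℝ) (i : Finset.range t) => id (f i)) ⁻¹'
      (ext ⁻¹' {φ | simulate g act φ t = x})
      = Prod.mk s ⁻¹' {φ : Scenario S | simulate g act φ t = x} := by
    refine Set.ext fun f => ?_
    simp only [Set.mem_preimage, Set.mem_ofPred_eq]
    rw [simulate_congr g act (φ := ext fun i => id (f i)) (ψ := (s, f)) (t := t) rfl
      fun i hi => by simp [ext, hi]]
  rw [h1] at key
  refine key.trans ?_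
  congr 1
  exact (measurePreserving_eval_infinitePi (fun _ : ℕ => uniform01) t).measure_preimage
    hB.nullMeasurableSet

omit [Countable S] [DiscreteMeasurableSpace S] [Finite A] [Finite Z]
  [DiscreteMeasurableSpace Z] in
-- The appended action is determined, so a reachable target fixes the new state and observation and
-- both sums collapse to one term; otherwise both sides vanish.
theorem uniform01_simulateStep (hg : IsSimulativeModel M g) (act : Strategy A Z)
    (x y : S × History A Z) :
    uniform01 {r | simulateStep g act x r = y} =
      ((M.T x.1 (act x.2)).bind fun s' =>
        (M.O s' (act x.2)).map fun z => (s', x.2 ++ [(act x.2, z)])) y := by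
  classical
  obtain ⟨s, h⟩ := x
  simp only [PMF.bind_apply, PMF.map_apply]
  by_cases hy : ∃ z, y.2 = h ++ [(act h, z)]
  · obtain ⟨z, hz⟩ := hy
    obtain ⟨s', h'⟩ := y
    obtain rfl : h' = _ := hz
    rw [tsum_eq_single s', tsum_eq_single z]
    · have := hg.distributed s (act h) s' z
      simpa [simulateStep, Prod.ext_iff] using this
    · intro z' hz'
      simp [hz'.symm]
    · intro s'' hs
      simp [hs.symm]
  · have h1 : {r | simulateStep g act (s, h) r = y} = ∅ := by
      refine Set.eq_empty_of_forall_notMem fun r hr => hy ⟨(g s (act h) r).2, ?_⟩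
      rw [← show simulateStep g act (s, h) r = y from hr]
      rfl
    rw [h1, measure_empty, eq_comm]
    refine ENNReal.tsum_eq_zero.2 fun s' => ?_
    refine mul_eq_zero_of_right _ (ENNReal.tsum_eq_zero.2 fun z => if_neg fun e => hy ⟨z, ?_⟩)
    rw [e]

/-- The simulation of a strategy reproduces the law of its execution. -/
theorem scenarioLaw_simulate_eq (hg : IsSimulativeModel M g) (b : PMF S) (act : Strategy A Z)
    (t : ℕ) (x : S × History A Z) :
    scenarioLaw b {φ | simulate g act φ t = x} = M.law b act t x := by
  induction t generalizing x with
  | zero =>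
    have : {φ : Scenario S | simulate g act φ 0 = x}
        = {s : S | (s, ([] : History A Z)) = x} ×ˢ Set.univ := by
      ext φ
      simp [simulate]
    rw [this, scenarioLaw, Measure.prod_prod, measure_univ, mul_one, POMDP.law]
    rw [PMF.toMeasure_apply _ .of_discrete, PMF.map_apply]
    refine tsum_congr fun s => ?_
    by_cases h : x = (s, [])
    · subst h
      simp
    · rw [if_neg h]
      have h' : s ∉ {s : S | (s, ([] : History A Z)) = x} := fun e => h (Eq.symm e)
      exact Set.indicator_of_notMem h' _
  | succ t ih =>
    have : {φ : Scenario S | simulate g act φ (t + 1) = x} = ⋃ y : S × History A Z,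
        {φ : Scenario S | simulate g act φ t = y} ∩
          (fun φ : Scenario S => φ.2 t) ⁻¹' {r | simulateStep g act y r = x} := by
      ext φ
      simp [simulate_succ]
    rw [this, measure_iUnion, POMDP.law, PMF.bind_apply]
    · refine tsum_congr fun y => ?_
      rw [scenarioLaw_simulate_inter hg b act t y (measurableSet_simulateStep hg act y x), ih,
        uniform01_simulateStep hg]
    · intro y y' hyy
      refine Set.disjoint_left.2 fun φ hφ hφ' => hyy ?_
      exact (show simulate g act φ t = y from hφ.1).symm.trans hφ'.1
    · exact fun y => (measurableSet_simulate_eq hg act t y).inter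
        (((measurable_pi_apply t).comp measurable_snd) (measurableSet_simulateStep hg act y x))

instance (b : PMF S) : IsProbabilityMeasure (scenarioLaw b) := by
  unfold scenarioLaw
  infer_instance

variable {Rmax γ : ℝ}

theorem integral_reward_simulate (hR : ∀ s a, 0 ≤ M.R s a ∧ M.R s a ≤ Rmax)
    (hg : IsSimulativeModel M g) (b : PMF S) (act : Strategy A Z) (t : ℕ) :
    ∫ φ, M.R (simulate g act φ t).1 (act (simulate g act φ t).2) ∂scenarioLaw b
      = M.expectedReward b act t := by
  let _ : MeasurableSpace (History A Z) := ⊤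
  have : DiscreteMeasurableSpace (History A Z) := ⟨fun _ => trivial⟩
  have hm : Measurable fun φ : Scenario S => simulate g act φ t :=
    measurable_comp_simulate hg act t id
  have hmap : (scenarioLaw b).map (fun φ => simulate g act φ t) = (M.law b act t).toMeasure := by
    refine Measure.ext_of_singleton fun x => ?_
    rw [Measure.map_apply hm (.singleton x), PMF.toMeasure_apply_singleton _ _ (.singleton x)]
    exact scenarioLaw_simulate_eq hg b act t x
  have hf : Measurable fun x : S × History A Z => M.R x.1 (act x.2) := .of_discrete
  rw [← integral_map (f := fun x : S × History A Z => M.R x.1 (act x.2)) hm.aemeasurable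
    hf.aestronglyMeasurable, hmap, PMF.integral_eq_tsum]
  · rfl
  · exact Integrable.of_mem_Icc 0 Rmax hf.aemeasurable (.of_forall fun x => hR _ _)

theorem summable_discounted (hγ0 : 0 ≤ γ) (hγ1 : γ < 1) {r : ℕ → ℝ}
    (hr : ∀ t, 0 ≤ r t ∧ r t ≤ Rmax) : Summable fun t => γ ^ t * r t :=
  Summable.of_nonneg_of_le (fun t => mul_nonneg (pow_nonneg hγ0 t) (hr t).1)
    (fun t => mul_le_mul_of_nonneg_left (hr t).2 (pow_nonneg hγ0 t))
    ((summable_geometric_of_lt_one hγ0 hγ1).mul_right Rmax)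

theorem tsum_discounted_mem_Icc (hγ0 : 0 ≤ γ) (hγ1 : γ < 1) {r : ℕ → ℝ}
    (hr : ∀ t, 0 ≤ r t ∧ r t ≤ Rmax) : ∑' t, γ ^ t * r t ∈ Set.Icc 0 (Rmax / (1 - γ)) := by
  refine ⟨tsum_nonneg fun t => mul_nonneg (pow_nonneg hγ0 t) (hr t).1, ?_⟩
  calc _ ≤ ∑' t, γ ^ t * Rmax :=
        (summable_discounted hγ0 hγ1 hr).tsum_le_tsum
          (fun t => mul_le_mul_of_nonneg_left (hr t).2 (pow_nonneg hγ0 t))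
          ((summable_geometric_of_lt_one hγ0 hγ1).mul_right Rmax)
    _ = _ := by
        rw [tsum_mul_right, tsum_geometric_of_lt_one hγ0 hγ1, div_eq_inv_mul]

theorem measurable_scenarioValue (hg : IsSimulativeModel M g) (act : Strategy A Z) :
    Measurable (scenarioValue M g γ act) :=
  Measurable.tsum fun t => (measurable_comp_simulate hg act t
    fun x => M.R x.1 (act x.2)).const_mul _

omit [Countable S] [MeasurableSpace S] [DiscreteMeasurableSpace S]
  [Finite A] [Finite Z] [MeasurableSpace Z] [DiscreteMeasurableSpace Z] in
theorem scenarioValue_mem_Icc (hR : ∀ s a, 0 ≤ M.R s a ∧ M.R s a ≤ Rmax)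
    (hγ0 : 0 ≤ γ) (hγ1 : γ < 1) (act : Strategy A Z) (φ : Scenario S) :
    scenarioValue M g γ act φ ∈ Set.Icc 0 (Rmax / (1 - γ)) :=
  tsum_discounted_mem_Icc hγ0 hγ1 fun _ => hR _ _

/-- Unbiasedness: domination by a geometric series allows integration term by term. -/
theorem integral_scenarioValue (hR : ∀ s a, 0 ≤ M.R s a ∧ M.R s a ≤ Rmax)
    (hγ0 : 0 ≤ γ) (hγ1 : γ < 1) (hg : IsSimulativeModel M g) (b : PMF S) (act : Strategy A Z) :
    ∫ φ, scenarioValue M g γ act φ ∂scenarioLaw b = M.value γ b act := by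
  have hmeas : ∀ t, Measurable fun φ : Scenario S =>
      M.R (simulate g act φ t).1 (act (simulate g act φ t).2) := fun t =>
    measurable_comp_simulate hg act t fun x => M.R x.1 (act x.2)
  have hint : ∀ t, Integrable (fun φ : Scenario S =>
      M.R (simulate g act φ t).1 (act (simulate g act φ t).2)) (scenarioLaw b) := fun t =>
    Integrable.of_mem_Icc 0 Rmax (hmeas t).aemeasurable (.of_forall fun x => hR _ _)
  have hs := hasSum_integral_of_summable_integral_norm (μ := scenarioLaw b)
    (F := fun t φ => γ ^ t * M.R (simulate g act φ t).1 (act (simulate g act φ t).2))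
    (fun t => (hint t).const_mul _) (by
      simp only [norm_mul, norm_pow, Real.norm_eq_abs, abs_of_nonneg hγ0,
        abs_of_nonneg (hR _ _).1, integral_const_mul]
      refine summable_discounted (Rmax := Rmax) hγ0 hγ1 fun t =>
        ⟨integral_nonneg fun φ => (hR _ _).1, ?_⟩
      calc _ ≤ ∫ _, Rmax ∂scenarioLaw b :=
            integral_mono (hint t) (integrable_const _) fun φ => (hR _ _).2
        _ = Rmax := by simp)
  simp only [integral_const_mul, integral_reward_simulate hR hg] at hs
  exact hs.tsum_eq.symm

end Law


/-! ### Policy trees derived from the DESPOT -/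

section DerivedPolicies

variable {S A Z : Type*} {M : POMDP S A Z} {g : S → A → ℝ → S × Z} {Rmax γ : ℝ}

theorem simulate_congr_strategy {act act' : Strategy A Z} {φ : Scenario S} {t : ℕ}
    (h : ∀ i < t, act (simulate g act φ i).2 = act' (simulate g act φ i).2) :
    simulate g act φ t = simulate g act' φ t := by
  induction t with
  | zero => rfl
  | succ t ih =>
    have h1 := ih fun i hi => h i (hi.trans t.lt_succ_self)
    have h2 := h t t.lt_succ_self
    simp only [simulate, h2]
    simp only [h1]

theorem simulate_mem_despotNodes (g : S → A → ℝ → S × Z) (act : Strategy A Z) {K D : ℕ}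
    (φ : Fin K → Scenario S) (k : Fin K) {t : ℕ} (ht : t ≤ D) :
    (simulate g act (φ k) t).2 ∈ despotNodes g φ D := by
  -- Under a fixed scenario a strategy is deterministic, so its actions form an open-loop sequence.
  refine ⟨fun i => act (simulate g act (φ k) i).2, k, t, ht, ?_⟩
  rw [simulate_congr_strategy]
  intro i _
  simp only [simulate_length]

theorem mem_despotNodes_of_append {K D : ℕ} {φ : Fin K → Scenario S} {h : History A Z} {a : A}
    {z : Z} (hh : h ++ [(a, z)] ∈ despotNodes g φ D) : h ∈ despotNodes g φ D := by
  obtain ⟨u, k, t, ht, he⟩ := hh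
  cases t with
  | zero => simp [simulate] at he
  | succ t =>
    rw [simulate_succ, simulateStep] at he
    rw [List.append_inj_left' he rfl]
    exact simulate_mem_despotNodes g _ φ k (Nat.le_of_succ_le ht)

/-- All ancestors of an internal node are internal and prescribe the actions on the path to it, so
the tree itself follows `u` up to that node. -/
theorem PolicyTree.simulate_eq_of_internal (q : PolicyTree A Z) (dflt : Strategy A Z) (u : ℕ → A)
    (φ : Scenario S) {t : ℕ} (h : (simulate g (fun h' => u h'.length) φ t).2 ∈ q.internal) :
    simulate g (fun h' => u h'.length) φ t = simulate g (q.exec dflt) φ t := by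
  induction t with
  | zero => rfl
  | succ t ih =>
    have h1 := q.choice_parent _ _ _ h
    have h2 := ih (by simp [PolicyTree.internal, h1])
    have h3 : q.exec dflt (simulate g (fun h' => u h'.length) φ t).2
        = u (simulate g (fun h' => u h'.length) φ t).2.length := by
      rw [PolicyTree.exec, h1, Option.getD_some]
    simp only [simulate, ← h2, h3]

theorem internal_subset_of_mem_despotPolicies {K D : ℕ} {φ : Fin K → Scenario S}
    {q : PolicyTree A Z} (hq : q ∈ despotPolicies g φ D) (dflt : Strategy A Z) :
    q.internal ⊆ Set.range fun x : Fin K × Fin D =>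
      (simulate g (q.exec dflt) (φ x.1) x.2).2 := by
  intro h hh
  obtain ⟨⟨u, k, t, -, rfl⟩, hlen⟩ := hq h hh
  rw [simulate_length] at hlen
  exact ⟨(k, ⟨t, hlen⟩), by rw [q.simulate_eq_of_internal dflt u (φ k) hh]⟩

theorem finite_internal_of_mem_despotPolicies {K D : ℕ} {φ : Fin K → Scenario S}
    {q : PolicyTree A Z} (hq : q ∈ despotPolicies g φ D) (dflt : Strategy A Z) :
    q.internal.Finite :=
  (Set.finite_range _).subset (internal_subset_of_mem_despotPolicies hq dflt)

theorem size_le_of_mem_despotPolicies {K D : ℕ} {φ : Fin K → Scenario S}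
    {q : PolicyTree A Z} (hq : q ∈ despotPolicies g φ D) (dflt : Strategy A Z) :
    q.size ≤ K * D := by
  refine (Set.ncard_le_ncard (internal_subset_of_mem_despotPolicies hq dflt)
    (Set.finite_range _)).trans ?_
  rw [← Set.image_univ]
  refine (Set.ncard_image_le Set.finite_univ).trans ?_
  simp [Set.ncard_univ]

/-- The first `D` rewards agree; of the two tails one is nonnegative and the other at most γ^D
R_max/(1-γ). -/
theorem scenarioValue_le_add (hR : ∀ s a, 0 ≤ M.R s a ∧ M.R s a ≤ Rmax)
    (hγ0 : 0 ≤ γ) (hγ1 : γ < 1) {act act' : Strategy A Z} {φ : Scenario S} {D : ℕ}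
    (h : ∀ t < D, act (simulate g act φ t).2 = act' (simulate g act φ t).2) :
    scenarioValue M g γ act φ ≤ scenarioValue M g γ act' φ + γ ^ D * (Rmax / (1 - γ)) := by
  have hs : ∀ b : Strategy A Z, Summable fun t =>
      γ ^ t * M.R (simulate g b φ t).1 (b (simulate g b φ t).2) := fun b =>
    summable_discounted hγ0 hγ1 fun t => hR _ _
  rw [scenarioValue, scenarioValue, ← (hs act).sum_add_tsum_nat_add D,
    ← (hs act').sum_add_tsum_nat_add D]
  have h1 : ∑ t ∈ Finset.range D, γ ^ t * M.R (simulate g act φ t).1 (act (simulate g act φ t).2)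
      = ∑ t ∈ Finset.range D,
        γ ^ t * M.R (simulate g act' φ t).1 (act' (simulate g act' φ t).2) := by
    refine Finset.sum_congr rfl fun t ht => ?_
    have ht' := Finset.mem_range.1 ht
    rw [h t ht', simulate_congr_strategy fun i hi => h i (hi.trans ht')]
  have h2 : ∀ b : Strategy A Z,
      ∑' t, γ ^ (t + D) * M.R (simulate g b φ (t + D)).1 (b (simulate g b φ (t + D)).2)
        = γ ^ D * ∑' t, γ ^ t * M.R (simulate g b φ (t + D)).1 (b (simulate g b φ (t + D)).2) := by
    intro b
    rw [← tsum_mul_left]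
    exact tsum_congr fun t => by ring
  have h3 : ∀ b : Strategy A Z,
      ∑' t, γ ^ t * M.R (simulate g b φ (t + D)).1 (b (simulate g b φ (t + D)).2)
        ∈ Set.Icc 0 (Rmax / (1 - γ)) := fun b =>
    tsum_discounted_mem_Icc hγ0 hγ1 fun t => hR _ _
  rw [h1, h2, h2]
  have h4 := mul_nonneg (pow_nonneg hγ0 D) (h3 act').1
  have h5 := mul_le_mul_of_nonneg_left (h3 act).2 (pow_nonneg hγ0 D)
  linarith

/-- Truncating a policy tree to the internal nodes of the DESPOT. -/
theorem exists_mem_despotPolicies_empiricalValue_le (hR : ∀ s a, 0 ≤ M.R s a ∧ M.R s a ≤ Rmax)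
    (hγ0 : 0 ≤ γ) (hγ1 : γ < 1) (dflt : Strategy A Z) {K : ℕ} (hK : 0 < K)
    (φ : Fin K → Scenario S) (D : ℕ) (p : PolicyTree A Z) (hp : p.internal.Finite) :
    ∃ q ∈ despotPolicies g φ D, q.size ≤ p.size ∧
      empiricalValue M g γ φ (p.exec dflt) ≤
        empiricalValue M g γ φ (q.exec dflt) + γ ^ D * (Rmax / (1 - γ)) := by
  classical
  let q : PolicyTree A Z :=
    { choice := fun h => if h ∈ despotNodes g φ D ∧ h.length < D then p.choice h else none
      choice_parent := by
        intro h a z hh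
        have h1 : h ++ [(a, z)] ∈ despotNodes g φ D ∧ (h ++ [(a, z)]).length < D := by
          by_contra hn
          exact hh (if_neg hn)
        rw [if_pos h1] at hh
        have h2 : h.length < D := by
          have := h1.2
          rw [List.length_append, List.length_singleton] at this
          omega
        rw [if_pos ⟨mem_despotNodes_of_append h1.1, h2⟩]
        exact p.choice_parent h a z hh }
  have hsub : q.internal ⊆ p.internal := by
    intro h hh hn
    refine hh ?_
    simp [q, hn]
  refine ⟨q, fun h hh => ?_, Set.ncard_le_ncard hsub hp, ?_⟩
  · by_contra hn
    exact hh (if_neg hn)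
  · have hK' : (0 : ℝ) < K := by exact_mod_cast hK
    rw [empiricalValue, empiricalValue, div_add' _ _ _ hK'.ne', div_le_div_iff_of_pos_right hK']
    calc _ ≤ ∑ k, (scenarioValue M g γ (q.exec dflt) (φ k) + γ ^ D * (Rmax / (1 - γ))) := by
          -- On sampled scenarios every node visited before depth `D` survives the truncation.
          refine Finset.sum_le_sum fun k _ => scenarioValue_le_add hR hγ0 hγ1 fun t ht => ?_
          simp only [PolicyTree.exec, q]
          rw [if_pos ⟨simulate_mem_despotNodes g _ φ k ht.le, by rwa [simulate_length]⟩]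
      _ = _ := by
          rw [Finset.sum_add_distrib]
          simp [mul_comm]

end DerivedPolicies

/-! ### The union bound over tree sizes -/

section UnionBound

theorem exp_neg_log_add_mul_log {τ x : ℝ} (hτ : 0 < τ) (hx : 0 < x) (i : ℕ) :
    Real.exp (-(Real.log (8 / τ) + i * Real.log x)) = τ / 8 * (x ^ i)⁻¹ := by
  rw [neg_add, Real.exp_add, ← Real.log_inv, Real.exp_log (by positivity), Real.exp_neg,
    Real.exp_nat_mul, Real.exp_log hx, inv_div]

/-- Here n = KD and m = |A||Z|. Since i! ≤ n^i for i < n, each of the sizes 1, …, n contributes at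
most τ/(8n); size 0 contributes at most τ/8. -/
theorem sum_card_mul_exp_le {τ : ℝ} (hτ : 0 < τ) {n m : ℕ} (hn : 0 < n) (hm : 0 < m)
    (c : ℕ → ℕ) (hc : ∀ i, c i ≤ (i - 1).factorial * m ^ i) :
    ∑ i ∈ Finset.range (n + 1), c i * Real.exp (-(Real.log (8 / τ) + i * Real.log (n * m)))
      ≤ τ / 4 := by
  have hn' : (0 : ℝ) < n := by exact_mod_cast hn
  have hm' : (0 : ℝ) < m := by exact_mod_cast hm
  simp only [exp_neg_log_add_mul_log hτ (mul_pos hn' hm')]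
  have hsucc : ∀ i ∈ Finset.range n,
      (c (i + 1) : ℝ) * (τ / 8 * ((n * m : ℝ) ^ (i + 1))⁻¹) ≤ τ / 8 / n := by
    intro i hi
    have h1 : c (i + 1) ≤ n ^ i * m ^ (i + 1) :=
      (hc (i + 1)).trans (Nat.mul_le_mul_right _ ((Nat.factorial_le_pow i).trans
        (Nat.pow_le_pow_left (Finset.mem_range.1 hi).le i)))
    have h2 : (c (i + 1) : ℝ) ≤ n ^ i * m ^ (i + 1) := by exact_mod_cast h1
    calc _ ≤ ((n : ℝ) ^ i * m ^ (i + 1)) * (τ / 8 * ((n * m : ℝ) ^ (i + 1))⁻¹) := by gcongr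
      _ = _ := by
        field_simp
        ring
  have hzero : (c 0 : ℝ) ≤ 1 := by exact_mod_cast by simpa using hc 0
  rw [Finset.sum_range_succ']
  have h3 := Finset.sum_le_card_nsmul _ _ _ hsucc
  rw [Finset.card_range, nsmul_eq_mul, mul_div_cancel₀ _ hn'.ne'] at h3
  have h4 : (c 0 : ℝ) * (τ / 8 * ((n * m : ℝ) ^ 0)⁻¹) ≤ τ / 8 := by
    rw [pow_zero, inv_one, mul_one]
    exact mul_le_of_le_one_left (by positivity) hzero
  linarith

end UnionBound

/-! ### Deviation bounds for policy values -/

section Deviation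

variable {S A Z : Type*} [Countable S] [MeasurableSpace S] [DiscreteMeasurableSpace S]
  [Finite A] [Finite Z] [MeasurableSpace Z] [DiscreteMeasurableSpace Z]
  {M : POMDP S A Z} {g : S → A → ℝ → S × Z} {γ Rmax : ℝ}

theorem measurable_empiricalValue (hg : IsSimulativeModel M g) (act : Strategy A Z) (K : ℕ) :
    Measurable fun φ : Fin K → Scenario S => empiricalValue M g γ φ act :=
  (Finset.measurable_sum _ fun k _ =>
    (measurable_scenarioValue hg act).comp (measurable_pi_apply k)).div_const _

theorem sampleLaw_value_lt_le (hR : ∀ s a, 0 ≤ M.R s a ∧ M.R s a ≤ Rmax)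
    (hγ0 : 0 ≤ γ) (hγ1 : γ < 1) (hg : IsSimulativeModel M g) (b : PMF S) (act : Strategy A Z)
    {K : ℕ} (hK : 0 < K) {α : ℝ} (hα0 : 0 < α) (hα1 : α < 1) (L : ℝ) :
    (sampleLaw b K).real {φ | M.value γ b act < (1 - α) / (1 + α) * empiricalValue M g γ φ act
      - Rmax / ((1 + α) * (1 - γ)) * (L / (α * K))} ≤ Real.exp (-L) := by
  have := measureReal_integral_lt_empirical_mean_le (ν := scenarioLaw b)
    (measurable_scenarioValue hg act) (scenarioValue_mem_Icc hR hγ0 hγ1 act) hK hα0 hα1 L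
  rwa [integral_scenarioValue hR hγ0 hγ1 hg, div_div, mul_comm (1 - γ)] at this

theorem sampleLaw_empiricalValue_lt_le (hR : ∀ s a, 0 ≤ M.R s a ∧ M.R s a ≤ Rmax)
    (hγ0 : 0 ≤ γ) (hγ1 : γ < 1) (hg : IsSimulativeModel M g) (b : PMF S) (act : Strategy A Z)
    {K : ℕ} (hK : 0 < K) {ε : ℝ} (hε : 0 ≤ ε) :
    (sampleLaw b K).real {φ | empiricalValue M g γ φ act < M.value γ b act
      - Rmax / (1 - γ) * ε} ≤ Real.exp (-2 * K * ε ^ 2) := by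
  have := measureReal_empirical_mean_lt_le (ν := scenarioLaw b)
    (measurable_scenarioValue hg act) (scenarioValue_mem_Icc hR hγ0 hγ1 act) hK hε
  rwa [integral_scenarioValue hR hγ0 hγ1 hg] at this

instance (b : PMF S) (K : ℕ) : IsProbabilityMeasure (sampleLaw b K) := by
  unfold sampleLaw
  infer_instance

end Deviation

end Despot

/-! ### Assembly of the performance bound -/

theorem theorem2 {S A Z : Type*} [Countable S] [MeasurableSpace S] [DiscreteMeasurableSpace S]
    [Fintype A] [Fintype Z] [MeasurableSpace Z] [DiscreteMeasurableSpace Z]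
    (M : Despot.POMDP S A Z) (γ Rmax : ℝ) (hγ0 : 0 ≤ γ) (hγ1 : γ < 1)
    (hR : ∀ s a, 0 ≤ M.R s a ∧ M.R s a ≤ Rmax)
    (g : S → A → ℝ → S × Z) (hg : Despot.IsSimulativeModel M g)
    (dflt : Despot.Strategy A Z) (b₀ : PMF S)
    (D K : ℕ) (hD : 0 < D) (hK : 0 < K)
    (τ α : ℝ) (hτ0 : 0 < τ) (hτ1 : τ < 1) (hα0 : 0 < α) (hα1 : α < 1)
    (p : Despot.PolicyTree A Z) (hp : p.internal.Finite) :
    ∃ E : Set (Fin K → Despot.Scenario S), MeasurableSet E ∧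
      ENNReal.ofReal (1 - τ) ≤ Despot.sampleLaw b₀ K E ∧
      ∀ φ ∈ E, ∀ q ∈ Despot.despotPolicies g φ D,
        IsMaxOn (Despot.regularizedValue M g γ Rmax α dflt φ D)
          (Despot.despotPolicies g φ D) q →
        M.value γ b₀ (q.exec dflt) ≥
          (1 - α) / (1 + α) * M.value γ b₀ (p.exec dflt)
            - Rmax / ((1 + α) * (1 - γ)) *
              ((Real.log (8 / τ)
                  + (p.size : ℝ) * Real.log ((K : ℝ) * D * Fintype.card A * Fintype.card Z))
                  / (α * K)
                + (1 - α) * (Real.sqrt (2 * Real.log (2 / τ) / K) + γ ^ D)) := by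
  classical
  obtain ⟨s₀, -⟩ := b₀.support_nonempty
  have : Nonempty A := ⟨dflt []⟩
  have : Nonempty Z := (M.O s₀ (dflt [])).support_nonempty.to_type
  have hRmax : 0 ≤ Rmax := (hR s₀ (dflt [])).1.trans (hR s₀ (dflt [])).2
  have hK' : (0 : ℝ) < K := by exact_mod_cast hK
  have hγ' : 0 < 1 - γ := by linarith
  have hα' : 0 < 1 - α := by linarith
  choose F hF hcard using Despot.exists_finset_policyTree_of_size (A := A) (Z := Z)
  set l := Real.log ((K : ℝ) * D * Fintype.card A * Fintype.card Z) with hl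
  have hlog : Real.log ((K * D : ℕ) * (Fintype.card A * Fintype.card Z : ℕ)) = l := by
    rw [hl]
    push_cast
    ring_nf
  have hl0 : 0 ≤ l := by
    rw [← hlog, ← Nat.cast_mul]
    exact Real.log_natCast_nonneg _
  set ε := Real.sqrt (2 * Real.log (2 / τ) / K)
  have hlog2 : 0 < Real.log (2 / τ) := Real.log_pos (by rw [lt_div_iff₀ hτ0]; linarith)
  have hε2 : ε ^ 2 = 2 * Real.log (2 / τ) / K := Real.sq_sqrt (by positivity)
  let bad (q : Despot.PolicyTree A Z) : Set (Fin K → Despot.Scenario S) :=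
    {φ | M.value γ b₀ (q.exec dflt) <
      (1 - α) / (1 + α) * Despot.empiricalValue M g γ φ (q.exec dflt)
        - Rmax / ((1 + α) * (1 - γ)) * ((Real.log (8 / τ) + q.size * l) / (α * K))}
  let low : Set (Fin K → Despot.Scenario S) :=
    {φ | Despot.empiricalValue M g γ φ (p.exec dflt) <
      M.value γ b₀ (p.exec dflt) - Rmax / (1 - γ) * ε}
  -- The union runs over all trees of size at most KD, not over the derived ones, which vary with
  -- the sample.
  let U : Set (Fin K → Despot.Scenario S) :=
    (⋃ i ∈ Finset.range (K * D + 1), ⋃ q ∈ F i, bad q) ∪ low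
  have hmU : MeasurableSet U := by
    refine .union (Finset.measurableSet_biUnion _ fun i _ =>
      Finset.measurableSet_biUnion _ fun q _ => ?_) ?_
    · exact measurableSet_lt measurable_const
        (((Despot.measurable_empiricalValue hg _ K).const_mul _).sub_const _)
    · exact measurableSet_lt (Despot.measurable_empiricalValue hg _ K) measurable_const
  have hlow : (Despot.sampleLaw b₀ K).real low ≤ τ / 2 := by
    refine (Despot.sampleLaw_empiricalValue_lt_le hR hγ0 hγ1 hg b₀ _ hK
      (Real.sqrt_nonneg _)).trans ?_
    -- There is slack: Hoeffding gives (τ/2)^4 where τ/2 suffices.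
    calc Real.exp (-2 * K * ε ^ 2) = Real.exp (-(4 * Real.log (2 / τ))) := by
          rw [hε2]
          congr 1
          field_simp
          ring
      _ ≤ Real.exp (-Real.log (2 / τ)) := Real.exp_le_exp.2 (by linarith)
      _ = τ / 2 := by
          rw [← Real.log_inv, Real.exp_log (by positivity), inv_div]
  have hbad : (Despot.sampleLaw b₀ K).real (⋃ i ∈ Finset.range (K * D + 1), ⋃ q ∈ F i, bad q)
      ≤ τ / 4 := by
    refine (measureReal_biUnion_finset_le _ _).trans (le_trans (Finset.sum_le_sum fun i _ => ?_)
      (Despot.sum_card_mul_exp_le hτ0 (Nat.mul_pos hK hD)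
        (Nat.mul_pos Fintype.card_pos Fintype.card_pos) (fun i => (F i).card) hcard))
    refine (measureReal_biUnion_finset_le _ _).trans ?_
    rw [← nsmul_eq_mul]
    refine Finset.sum_le_card_nsmul _ _ _ fun q hq => ?_
    rw [hlog, ← ((hF i q).1 hq).2]
    exact Despot.sampleLaw_value_lt_le hR hγ0 hγ1 hg b₀ _ hK hα0 hα1 _
  have hU : (Despot.sampleLaw b₀ K).real U ≤ τ :=
    (measureReal_union_le _ _).trans (by linarith)
  refine ⟨Uᶜ, hmU.compl, ?_, ?_⟩
  · rw [← ofReal_measureReal, probReal_compl_eq_one_sub hmU]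
    exact ENNReal.ofReal_le_ofReal (by linarith)
  intro φ hφ q hq hmax
  have hq1 : ¬ φ ∈ bad q := fun h => hφ (Or.inl (Set.mem_biUnion (Finset.mem_range.2
    (Nat.lt_succ_of_le (Despot.size_le_of_mem_despotPolicies hq dflt)))
    (Set.mem_biUnion ((hF _ q).2
      ⟨Despot.finite_internal_of_mem_despotPolicies hq dflt, rfl⟩) h)))
  have hp1 : ¬ φ ∈ low := fun h => hφ (Or.inr h)
  obtain ⟨p', hp', hsize, hval⟩ := Despot.exists_mem_despotPolicies_empiricalValue_le (g := g)
    hR hγ0 hγ1 dflt hK φ D p hp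
  have hreg := hmax hp'
  simp only [bad, low, Set.mem_ofPred_eq, not_lt, Despot.regularizedValue, ← hl]
    at hq1 hp1 hreg
  set C := Rmax / ((1 + α) * (1 - γ)) with hC
  have hC0 : 0 ≤ C := by positivity
  have hB : (1 - α) / (1 + α) * (Rmax / (1 - γ)) = C * (1 - α) := by
    rw [hC]
    field_simp
  have h1 : (1 - α) / (1 + α) * (M.value γ b₀ (p.exec dflt) - Rmax / (1 - γ) * (ε + γ ^ D))
      ≤ (1 - α) / (1 + α) * Despot.empiricalValue M g γ φ (p'.exec dflt) :=
    mul_le_mul_of_nonneg_left (by linarith) (by positivity)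
  have h2 : (1 - α) / (1 + α) * (M.value γ b₀ (p.exec dflt) - Rmax / (1 - γ) * (ε + γ ^ D))
      = (1 - α) / (1 + α) * M.value γ b₀ (p.exec dflt) - C * ((1 - α) * (ε + γ ^ D)) := by
    rw [mul_sub, ← mul_assoc, hB, mul_assoc]
  have h3 : C * (p'.size * l / (α * K)) ≤ C * (p.size * l / (α * K)) := by
    have : (p'.size : ℝ) ≤ p.size := by exact_mod_cast hsize
    gcongr
  -- Splitting off ln(8/τ) leaves the regularized value of `q`, to which maximality applies.
  rw [add_div, mul_add] at hq1
  rw [add_div, mul_add, mul_add]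
  linarith
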